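/- **Theorem (critical points dense in a Cantor set, period tripling).** A *unimodal map* is a $C^1$ map $f:[0,1]\to[0,1]$ with a unique critical point $c\in(0,1)$, normalized by $f(c)=1$ and $f(1)=0$. It is of class $C^{1+Lip}$ if $f'$ is Lipschitz on $[0,1]$. It has a *quadratic tip* if there are $l>0$ and points $y_n\in[0,1]\setminus\{c\}$, $y_n\to c$, with $\lim_{n\to\infty}\frac{f(y_n)-f(c)}{(y_n-c)^2}=-l$. For a nondegenerate closed interval $J\subsetneq[0,1]$ and $n\ge 1$, the map $f^n:J\to J$ is a *renormalization* of $f$ if $J, f(J),\dots,f^{n-1}(J)$ have pairwise disjoint interiors and $f^n(J)\subseteq J$. The map $f$ is *period tripling renormalizable* if $f(0)<c<f^4(0)$ and $f^3:J\to J$ is a renormalization of $f$ for $J=[f(0),f^4(0)]$; then $Rf=h^{-1}\circ f^3\circ h$, where $h:[0,1]\to J$ is the orientation reversing affine homeomorphism. There exists a $C^{1+Lip}$ unimodal map $k$ with a quadratic tip such that: 1. $k$ is infinitely renormalizable: there are nested intervals $I_0\supseteq I_1\supseteq\cdots$ with $|I_n|\to 0$ such that $k^{3^{n+1}}:I_n\to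 I_n$ is a renormalization of $k$ for every $n\ge 0$; 2. for every $n\ge0$, $R^nk$ is a $C^{1+Lip}$ unimodal map that is period tripling renormalizable; 3. if $c_n$ denotes the critical point of $R^nk$, there is a Cantor set $C\subset\mathbb{R}$ (nonempty, compact, perfect, totally disconnected) such that $\{c_n\}_{n\ge0}\subseteq C$ and $\{c_n\}_{n\ge0}$ is dense in $C$. -/

import Mathlib

open Set Filter Topology

/-- A unimodal map of `[0,1]`, in the standard normalization, with critical point `c`:
a `C¹` self-map of `[0,1]` whose unique critical point is `c`, which attains its maximum `1` at `c`
and sends `1` to `0`. (Hence `f` is strictly increasing on `[0,c]` and strictly decreasing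
on `[c,1]`.) Only the values of `f` on `[0,1]` matter. -/
structure IsUnimodal (f : ℝ → ℝ) (c : ℝ) : Prop where
  mapsTo : MapsTo f (Icc 0 1) (Icc 0 1)
  contDiffOn : ContDiffOn ℝ 1 f (Icc 0 1)
  crit_mem : c ∈ Ioo (0 : ℝ) 1
  crit_iff : ∀ x ∈ Icc (0 : ℝ) 1, derivWithin f (Icc 0 1) x = 0 ↔ x = c
  map_crit : f c = 1
  map_one : f 1 = 0

/-- `f` is of class `C^{1+Lip}` on `[0,1]`: it is `C¹` there with Lipschitz derivative. -/
def IsC1Lip (f : ℝ → ℝ) : Prop :=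
  ContDiffOn ℝ 1 f (Icc 0 1) ∧
    ∃ L : NNReal, LipschitzOnWith L (derivWithin f (Icc 0 1)) (Icc 0 1)

/-- `f` has a quadratic tip at `c`. -/
def HasQuadraticTip (f : ℝ → ℝ) (c : ℝ) : Prop :=
  ∃ (y : ℕ → ℝ) (l : ℝ), 0 < l ∧ (∀ n, y n ∈ Icc (0 : ℝ) 1 ∧ y n ≠ c) ∧
    Tendsto y atTop (𝓝 c) ∧
    Tendsto (fun n => (f (y n) - f c) / (y n - c) ^ 2) atTop (𝓝 (-l))

/-- `f^n : [a,b] → [a,b]` is a renormalization of the self-map `f` of `[0,1]`: `[a,b]` is a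
nondegenerate proper subinterval, its images `f^i([a,b])`, `0 ≤ i < n`, have pairwise disjoint
interiors, and `f^n([a,b]) ⊆ [a,b]`. -/
structure IsRenormalization (f : ℝ → ℝ) (a b : ℝ) (n : ℕ) : Prop where
  pos : 0 < n
  lt : a < b
  proper : Icc a b ⊂ Icc 0 1
  disjoint : ∀ i < n, ∀ j < n, i ≠ j →
    Disjoint (interior (f^[i] '' Icc a b)) (interior (f^[j] '' Icc a b))
  mapsTo : MapsTo f^[n] (Icc a b) (Icc a b)

/-- `f` is infinitely renormalizable with periods `p 0, p 1, …`: there are nested intervals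
`[a n, b n]`, of length tending to zero, on which `f^(p n)` is a renormalization of `f`. -/
def IsInfinitelyRenormalizable (f : ℝ → ℝ) (p : ℕ → ℕ) : Prop :=
  ∃ a b : ℕ → ℝ, (∀ n, IsRenormalization f (a n) (b n) (p n)) ∧
    (∀ n, Icc (a (n + 1)) (b (n + 1)) ⊆ Icc (a n) (b n)) ∧
    Tendsto (fun n => b n - a n) atTop (𝓝 0)

/-- A (normalized) unimodal map `f` with critical point `c` is period tripling renormalizable:
`f³ : J → J` is a renormalization for the interval `J = [f(0), f⁴(0)] = [f³(c), f⁶(c)]` around `c`.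
This is the only interval `J` around `c` for which rescaling `f³|J` by an orientation reversing
affine map can give a normalized unimodal map again. -/
def IsTriplingRenormalizable (f : ℝ → ℝ) (c : ℝ) : Prop :=
  IsRenormalization f (f 0) (f^[4] 0) 3 ∧ c ∈ Ioo (f 0) (f^[4] 0)

/-- The affine map `h` with `h 0 = f⁴(0)` and `h 1 = f(0)`; it is the orientation reversing affine
homeomorphism from `[0,1]` onto `J = [f(0), f⁴(0)]` when `f` is period tripling renormalizable. -/
def triplingChart (f : ℝ → ℝ) (t : ℝ) : ℝ := f 0 + (f^[4] 0 - f 0) * (1 - t)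

/-- The inverse of `triplingChart f` (when `f 0 < f⁴(0)`). -/
noncomputable def triplingChartInv (f : ℝ → ℝ) (x : ℝ) : ℝ := 1 - (x - f 0) / (f^[4] 0 - f 0)

/-- The period tripling renormalization operator `R f = h⁻¹ ∘ f³ ∘ h`. -/
noncomputable def triplingRenorm (f : ℝ → ℝ) : ℝ → ℝ :=
  triplingChartInv f ∘ f^[3] ∘ triplingChart f

/-- A Cantor set: a nonempty, compact, perfect, totally disconnected set. -/
def IsCantorSet (C : Set ℝ) : Prop :=
  C.Nonempty ∧ IsCompact C ∧ Perfect C ∧ IsTotallyDisconnected C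

/-! Renormalization is made to act as the shift on sequences of critical points. For any sequence
`c` in `critRange`, `cascade c` is the parabola 1 - (16/5)(x - c_0)^2 plus bumps, the m-th one
living at distance about 9^{-m} from c_0 and depending only on c_m and c_{m+1}. The bump m = 0 makes
the map affine on an interval ending at 1 (slope -3) and on one starting at 0 (slope 3); these
branches carry `chart₁` to `chart₂` and `chart₂` back to `chart₀`. Near c_0 that bump vanishes, and
magnifying by -9 turns the cascade of `c` into the cascade of its tail (`cascade_chart₀`). Composing
the three pieces, f^3 on J is affinely conjugate to `cascade (tail c)`, so the critical points of
the successive renormalizations are exactly the chosen c_n (`eqOn_iterate_triplingRenorm`). It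
remains to take `c` dense in a Cantor set inside `critRange`.

The bumps have disjoint supports and shrink like the parabola, by 81 in height when lengths shrink
by 9, so the Lipschitz bound on their derivatives is the same at every scale
(`exists_lipschitzWith_cascadeDeriv`). Unimodality also reduces to one scale, where the parabola's
slope dominates that of the bump (`profileDeriv_lt`). In the gaps between the bumps the map is
exactly the parabola, which gives the quadratic tip. -/

/-! ### A `C^{1,1}` cut-off function -/

/-- The square of the positive part. -/
noncomputable def posSq (x : ℝ) : ℝ := max x 0 ^ 2

lemma hasDerivAt_posSq (x : ℝ) : HasDerivAt posSq (2 * max x 0) x := by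
  rcases lt_trichotomy x 0 with h | rfl | h
  · have : posSq =ᶠ[𝓝 x] fun _ => 0 := by
      filter_upwards [Iio_mem_nhds h] with y hy
      simp [posSq, max_eq_right (le_of_lt (mem_Iio.1 hy))]
    rw [max_eq_right h.le, mul_zero]
    exact (hasDerivAt_const x (0 : ℝ)).congr_of_eventuallyEq this
  · have : posSq =O[𝓝 0] fun y => ‖y - 0‖ ^ 2 := by
      refine Asymptotics.IsBigO.of_bound 1 (Eventually.of_forall fun y => ?_)
      rw [posSq, one_mul, sub_zero, norm_pow, norm_pow, norm_norm, Real.norm_eq_abs,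
        Real.norm_eq_abs]
      refine pow_le_pow_left₀ (abs_nonneg _) ?_ 2
      rcases le_total y 0 with h | h
      · simp [max_eq_right h]
      · simp [max_eq_left h]
    have h := (this.hasFDerivAt one_lt_two).hasDerivAt
    simpa using h
  · have : posSq =ᶠ[𝓝 x] fun y => y ^ 2 := by
      filter_upwards [Ioi_mem_nhds h] with y hy
      simp [posSq, max_eq_left (le_of_lt (mem_Ioi.1 hy))]
    rw [max_eq_left h.le]
    simpa using (hasDerivAt_pow 2 x).congr_of_eventuallyEq this

/-- A cut-off function, equal to `1` on `[2/5, 14/25]` and to `0` off `[1/5, 19/25]`. -/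
noncomputable def cutoff (z : ℝ) : ℝ :=
  2 * (posSq (5 * z - 1) - 2 * posSq (5 * z - 3 / 2) + posSq (5 * z - 2)) -
    2 * (posSq (5 * z - 14 / 5) - 2 * posSq (5 * z - 33 / 10) + posSq (5 * z - 19 / 5))

/-- The derivative of `cutoff`. -/
noncomputable def cutoffDeriv (z : ℝ) : ℝ :=
  20 * (max (5 * z - 1) 0 - 2 * max (5 * z - 3 / 2) 0 + max (5 * z - 2) 0) -
    20 * (max (5 * z - 14 / 5) 0 - 2 * max (5 * z - 33 / 10) 0 + max (5 * z - 19 / 5) 0)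

lemma hasDerivAt_cutoff (z : ℝ) : HasDerivAt cutoff (cutoffDeriv z) z := by
  have key (e : ℝ) : HasDerivAt (fun z => posSq (5 * z - e)) (10 * max (5 * z - e) 0) z := by
    have h : HasDerivAt (fun z : ℝ => 5 * z - e) 5 z := by
      simpa using ((hasDerivAt_id z).const_mul 5).sub_const e
    refine ((hasDerivAt_posSq (5 * z - e)).comp z h).congr_deriv ?_
    ring
  refine ((((key 1).sub ((key (3 / 2)).const_mul 2)).add (key 2)).const_mul 2 |>.sub
    ((((key (14 / 5)).sub ((key (33 / 10)).const_mul 2)).add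
      (key (19 / 5))).const_mul 2)).congr_deriv ?_
  rw [cutoffDeriv]
  ring

lemma cutoff_eq_one {z : ℝ} (h₁ : 2 / 5 ≤ z) (h₂ : z ≤ 14 / 25) : cutoff z = 1 := by
  simp only [cutoff, posSq]
  rw [max_eq_left (by linarith), max_eq_left (by linarith), max_eq_left (by linarith),
    max_eq_right (by linarith), max_eq_right (by linarith), max_eq_right (by linarith)]
  ring

lemma cutoff_of_le {z : ℝ} (h : z ≤ 1 / 5) : cutoff z = 0 ∧ cutoffDeriv z = 0 := by
  simp only [cutoff, cutoffDeriv, posSq]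
  rw [max_eq_right (by linarith), max_eq_right (by linarith), max_eq_right (by linarith),
    max_eq_right (by linarith), max_eq_right (by linarith), max_eq_right (by linarith)]
  norm_num

lemma cutoff_of_ge {z : ℝ} (h : 19 / 25 ≤ z) : cutoff z = 0 ∧ cutoffDeriv z = 0 := by
  simp only [cutoff, cutoffDeriv, posSq]
  rw [max_eq_left (by linarith), max_eq_left (by linarith), max_eq_left (by linarith),
    max_eq_left (by linarith), max_eq_left (by linarith), max_eq_left (by linarith)]
  constructor <;> ring

/-! ### Bounded Lipschitz functions -/

/-- Bounded Lipschitz real functions. -/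
def IsBoundedLipschitz (f : ℝ → ℝ) : Prop :=
  ∃ C, 0 ≤ C ∧ (∀ x, |f x| ≤ C) ∧ ∀ x y, |f x - f y| ≤ C * |x - y|

namespace IsBoundedLipschitz

lemma const (a : ℝ) : IsBoundedLipschitz fun _ => a :=
  ⟨|a|, abs_nonneg a, fun _ => le_rfl, fun x y => by simp; positivity⟩

lemma add {f g : ℝ → ℝ} (hf : IsBoundedLipschitz f) (hg : IsBoundedLipschitz g) :
    IsBoundedLipschitz fun x => f x + g x := by
  obtain ⟨C, hC, hb, hl⟩ := hf
  obtain ⟨D, hD, hb', hl'⟩ := hg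
  refine ⟨C + D, by positivity, fun x => (abs_add_le _ _).trans (add_le_add (hb x) (hb' x)),
    fun x y => ?_⟩
  have := abs_add_le (f x - f y) (g x - g y)
  rw [show f x + g x - (f y + g y) = f x - f y + (g x - g y) by ring]
  linarith [hl x y, hl' x y]

lemma mul {f g : ℝ → ℝ} (hf : IsBoundedLipschitz f) (hg : IsBoundedLipschitz g) :
    IsBoundedLipschitz fun x => f x * g x := by
  obtain ⟨C, hC, hb, hl⟩ := hf
  obtain ⟨D, hD, hb', hl'⟩ := hg
  refine ⟨2 * C * D, by positivity, fun x => ?_, fun x y => ?_⟩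
  · rw [abs_mul]
    have := mul_le_mul (hb x) (hb' x) (abs_nonneg _) hC
    nlinarith [mul_nonneg hC hD]
  · have h₁ := mul_le_mul (hb x) (hl' x y) (abs_nonneg _) hC
    have h₂ := mul_le_mul (hb' y) (hl x y) (abs_nonneg _) hD
    have := abs_add_le (f x * (g x - g y)) (g y * (f x - f y))
    rw [abs_mul, abs_mul] at this
    rw [show f x * g x - f y * g y = f x * (g x - g y) + g y * (f x - f y) by ring]
    nlinarith

lemma max_zero {f : ℝ → ℝ} (hf : IsBoundedLipschitz f) :
    IsBoundedLipschitz fun x => max (f x) 0 := by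
  obtain ⟨C, hC, hb, hl⟩ := hf
  refine ⟨C, hC, fun x => ?_, fun x y => (abs_max_sub_max_le_abs _ _ _).trans (hl x y)⟩
  have := abs_max_sub_max_le_abs (f x) 0 0
  simp only [max_self, sub_zero] at this
  exact this.trans (hb x)

lemma clamp : IsBoundedLipschitz fun x => max 0 (min 1 x) := by
  refine ⟨1, zero_le_one, fun x => abs_le.2 ⟨?_, ?_⟩, fun x y => ?_⟩
  · linarith [le_max_left 0 (min 1 x)]
  · exact max_le zero_le_one (min_le_left _ _)
  · simp only [one_mul, max_comm (0 : ℝ), min_comm (1 : ℝ)]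
    refine (abs_max_sub_max_le_abs _ _ _).trans ?_
    exact abs_min_sub_min_le_max x 1 y 1 |>.trans (by simp)

lemma comp_affine {f : ℝ → ℝ} (hf : IsBoundedLipschitz f) (a b : ℝ) :
    IsBoundedLipschitz fun x => a * f x - b := by
  simpa [sub_eq_add_neg] using ((const a).mul hf).add (const (-b))

end IsBoundedLipschitz

/-- Clamping is harmless for functions supported in [1/5, 19/25], and it makes their polynomial
factors bounded and Lipschitz on the whole line. -/
lemma eq_comp_clamp {f : ℝ → ℝ} (h₀ : ∀ z ≤ 1 / 5, f z = 0) (h₁ : ∀ z, 19 / 25 ≤ z → f z = 0) :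
    f = fun z => f (max 0 (min 1 z)) := by
  funext z
  rcases le_total z 0 with h | h
  · rw [min_eq_right (h.trans zero_le_one), max_eq_left h, h₀ z (by linarith), h₀ 0 (by norm_num)]
  · rcases le_total z 1 with h' | h'
    · rw [min_eq_right h', max_eq_right h]
    · rw [min_eq_left h', max_eq_right zero_le_one, h₁ z (by linarith), h₁ 1 (by norm_num)]

lemma isBoundedLipschitz_cutoffDeriv_comp {f : ℝ → ℝ} (hf : IsBoundedLipschitz f) :
    IsBoundedLipschitz fun z => cutoffDeriv (f z) := by
  have h (e : ℝ) := (hf.comp_affine 5 e).max_zero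
  simpa [cutoffDeriv, sub_eq_add_neg] using
    (((h 1).add ((IsBoundedLipschitz.const (-2)).mul (h (3 / 2)))).add (h 2)
      |> (IsBoundedLipschitz.const 20).mul).add
    (((h (14 / 5)).add ((IsBoundedLipschitz.const (-2)).mul (h (33 / 10)))).add (h (19 / 5))
      |> (IsBoundedLipschitz.const (-20)).mul)

lemma isBoundedLipschitz_cutoff_comp {f : ℝ → ℝ} (hf : IsBoundedLipschitz f) :
    IsBoundedLipschitz fun z => cutoff (f z) := by
  have h (e : ℝ) : IsBoundedLipschitz fun z => posSq (5 * f z - e) := by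
    simpa only [posSq, sq] using (hf.comp_affine 5 e).max_zero.mul (hf.comp_affine 5 e).max_zero
  simpa [cutoff, sub_eq_add_neg] using
    (((h 1).add ((IsBoundedLipschitz.const (-2)).mul (h (3 / 2)))).add (h 2)
      |> (IsBoundedLipschitz.const 2).mul).add
    (((h (14 / 5)).add ((IsBoundedLipschitz.const (-2)).mul (h (33 / 10)))).add (h (19 / 5))
      |> (IsBoundedLipschitz.const (-2)).mul)

/-! ### One-sided profiles

Adding `profile r` to `1 - 16/5 z²` replaces the parabola by the affine function `r - 3 z` on
`[2/5, 14/25]`. -/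

/-- The correction turning the parabola `1 - 16/5 z²` into `r - 3 z` where the cut-off is `1`. -/
noncomputable def profile (r z : ℝ) : ℝ := cutoff z * (16 / 5 * z ^ 2 - 3 * z + r - 1)

/-- The derivative of `profile r`. -/
noncomputable def profileDeriv (r z : ℝ) : ℝ :=
  cutoffDeriv z * (16 / 5 * z ^ 2 - 3 * z + r - 1) + cutoff z * (32 / 5 * z - 3)

lemma hasDerivAt_profile (r z : ℝ) : HasDerivAt (profile r) (profileDeriv r z) z := by
  have h : HasDerivAt (fun z : ℝ => 16 / 5 * z ^ 2 - 3 * z + r - 1) (32 / 5 * z - 3) z := by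
    refine (((((hasDerivAt_pow 2 z).const_mul (16 / 5)).sub
      ((hasDerivAt_id z).const_mul 3)).add_const r).sub_const 1).congr_deriv ?_
    norm_num
    ring
  exact (hasDerivAt_cutoff z).mul h

lemma profile_of_le {z : ℝ} (r : ℝ) (h : z ≤ 1 / 5) : profile r z = 0 ∧ profileDeriv r z = 0 := by
  simp [profile, profileDeriv, cutoff_of_le h]

lemma profile_of_ge {z : ℝ} (r : ℝ) (h : 19 / 25 ≤ z) :
    profile r z = 0 ∧ profileDeriv r z = 0 := by
  simp [profile, profileDeriv, cutoff_of_ge h]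

lemma profile_eq {z : ℝ} (r : ℝ) (h₁ : 2 / 5 ≤ z) (h₂ : z ≤ 14 / 25) :
    profile r z = 16 / 5 * z ^ 2 - 3 * z + r - 1 := by
  rw [profile, cutoff_eq_one h₁ h₂, one_mul]

/-- The bound is uniform in r because `profileDeriv r` is affine in r, with slope `cutoffDeriv`; two
functions need to be controlled. -/
lemma exists_bound_profileDeriv : ∃ C, 0 ≤ C ∧ ∀ r ∈ Icc (0 : ℝ) 2,
    (∀ z, |profileDeriv r z| ≤ C) ∧
      ∀ z w, |profileDeriv r z - profileDeriv r w| ≤ C * |z - w| := by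
  have h₀ : IsBoundedLipschitz (profileDeriv 0) := by
    rw [eq_comp_clamp (f := profileDeriv 0) (fun z hz => (profile_of_le 0 hz).2)
      fun z hz => (profile_of_ge 0 hz).2]
    have k := IsBoundedLipschitz.clamp
    have q₁ := ((k.mul k).comp_affine (16 / 5) 1).add (k.comp_affine (-3) 0)
    have q₂ := k.comp_affine (32 / 5) 3
    convert ((isBoundedLipschitz_cutoffDeriv_comp k).mul q₁).add
      ((isBoundedLipschitz_cutoff_comp k).mul q₂) using 2
    rw [profileDeriv]
    ring
  have h₁ : IsBoundedLipschitz cutoffDeriv := by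
    rw [eq_comp_clamp (f := cutoffDeriv) (fun z hz => (cutoff_of_le hz).2)
      fun z hz => (cutoff_of_ge hz).2]
    exact isBoundedLipschitz_cutoffDeriv_comp IsBoundedLipschitz.clamp
  obtain ⟨C, hC, hb, hl⟩ := h₀
  obtain ⟨D, hD, hb', hl'⟩ := h₁
  have e (r z : ℝ) : profileDeriv r z = profileDeriv 0 z + r * cutoffDeriv z := by
    simp only [profileDeriv]
    ring
  refine ⟨C + 2 * D, by positivity, fun r hr => ⟨fun z => ?_, fun z w => ?_⟩⟩
  · rw [e]
    refine (abs_add_le _ _).trans (add_le_add (hb z) ?_)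
    rw [abs_mul, abs_of_nonneg hr.1]
    exact mul_le_mul hr.2 (hb' z) (abs_nonneg _) zero_le_two
  · rw [e, e r w, show profileDeriv 0 z + r * cutoffDeriv z - (profileDeriv 0 w + r * cutoffDeriv w)
      = (profileDeriv 0 z - profileDeriv 0 w) + r * (cutoffDeriv z - cutoffDeriv w) by ring, add_mul]
    refine (abs_add_le _ _).trans (add_le_add (hl z w) ?_)
    rw [abs_mul, abs_of_nonneg hr.1, mul_assoc]
    exact mul_le_mul hr.2 (hl' z w) (abs_nonneg _) zero_le_two

/-- The inequality says that d q is less than the convex combination (1 - χ)(32/5)z + 3χ, which is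
at least 32/25 because (32/5)z ≥ 32/25 when z ≥ 1/5, and 3 > 32/25. -/
lemma cutoff_deriv_combination_lt {χ d q z : ℝ} (h₀ : 0 ≤ χ) (h₁ : χ ≤ 1) (hz : 1 / 5 ≤ z)
    (hq : d * q < 32 / 25) : d * q + χ * (32 / 5 * z - 3) < 32 / 5 * z := by
  nlinarith [mul_nonneg (sub_nonneg.2 h₁) (sub_nonneg.2 hz)]

lemma profileDeriv_lt {r z : ℝ} (hr : r ∈ Icc (83 / 50 : ℝ) (43 / 25)) (hz : 0 < z) :
    profileDeriv r z < 32 / 5 * z := by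
  obtain ⟨hr₁, hr₂⟩ := hr
  rcases le_total z (1 / 5) with h₁ | h₁
  · rw [(profile_of_le r h₁).2]; linarith
  rcases le_total (19 / 25) z with h₇ | h₇
  · rw [(profile_of_ge r h₇).2]; linarith
  simp only [profileDeriv, cutoff, cutoffDeriv, posSq]
  rw [max_eq_left (a := 5 * z - 1) (by linarith), max_eq_right (a := 5 * z - 19 / 5) (by linarith)]
  rcases le_total z (3 / 10) with h₂ | h₂
  · rw [max_eq_right (a := 5 * z - 3 / 2) (by linarith), max_eq_right (a := 5 * z - 2) (by linarith),
      max_eq_right (a := 5 * z - 14 / 5) (by linarith),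
      max_eq_right (a := 5 * z - 33 / 10) (by linarith)]
    refine cutoff_deriv_combination_lt (by nlinarith) (by nlinarith) h₁ ?_
    -- Chord over [1/5, 3/10] of the convex quadratic with r = 43/25; 31/70 below is the vertex of
    -- w(31/125 - (7/25)w), where w = 5z - 1. On the next piece, 27/250 is the value of the
    -- quadratic at 3/10.
    have hq : 16 / 5 * z ^ 2 - 3 * z + r - 1 ≤ 31 / 125 - 7 / 25 * (5 * z - 1) := by nlinarith
    have := mul_le_mul_of_nonneg_left hq (show 0 ≤ 5 * z - 1 by linarith)
    nlinarith [sq_nonneg (5 * z - 1 - 31 / 70)]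
  rw [max_eq_left (a := 5 * z - 3 / 2) (by linarith)]
  rcases le_total z (2 / 5) with h₃ | h₃
  · rw [max_eq_right (a := 5 * z - 2) (by linarith),
      max_eq_right (a := 5 * z - 14 / 5) (by linarith),
      max_eq_right (a := 5 * z - 33 / 10) (by linarith)]
    refine cutoff_deriv_combination_lt (by nlinarith) (by nlinarith) h₁ ?_
    have hq : 16 / 5 * z ^ 2 - 3 * z + r - 1 ≤ 27 / 250 := by nlinarith
    have := mul_le_mul_of_nonneg_left hq (show 0 ≤ 2 - 5 * z by linarith)
    nlinarith
  rw [max_eq_left (a := 5 * z - 2) (by linarith)]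
  rcases le_total z (14 / 25) with h₄ | h₄
  · rw [max_eq_right (a := 5 * z - 14 / 5) (by linarith),
      max_eq_right (a := 5 * z - 33 / 10) (by linarith)]
    nlinarith
  rw [max_eq_left (a := 5 * z - 14 / 5) (by linarith)]
  rcases le_total z (33 / 50) with h₅ | h₅
  · rw [max_eq_right (a := 5 * z - 33 / 10) (by linarith)]
    refine cutoff_deriv_combination_lt (by nlinarith) (by nlinarith) h₁ ?_
    -- On the descending side of the cut-off d ≤ 0, so q needs a lower bound; its minimum is at z =
    -- 15/32, taken with r ≥ 83/50.
    have hq : -(1 / 20) ≤ 16 / 5 * z ^ 2 - 3 * z + r - 1 := by nlinarith [sq_nonneg (z - 15 / 32)]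
    have := mul_le_mul_of_nonneg_left hq (show 0 ≤ 5 * z - 14 / 5 by linarith)
    nlinarith
  · rw [max_eq_left (a := 5 * z - 33 / 10) (by linarith)]
    refine cutoff_deriv_combination_lt (by nlinarith) (by nlinarith) h₁ ?_
    have hq : -(1 / 20) ≤ 16 / 5 * z ^ 2 - 3 * z + r - 1 := by nlinarith [sq_nonneg (z - 15 / 32)]
    have := mul_le_mul_of_nonneg_left hq (show 0 ≤ 19 / 5 - 5 * z by linarith)
    nlinarith

/-! ### Series of rescaled bumps with disjoint supports -/

/-- The sets `{u | 1/5 < |(-9)^m u| < 19/25}`, `m : ℕ`, are pairwise disjoint. -/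
lemma exists_scale (u : ℝ) :
    ∃ j : ℕ, ∀ m ≠ j, |(-9) ^ m * u| ≤ 1 / 5 ∨ 19 / 25 ≤ |(-9) ^ m * u| := by
  have habs (m : ℕ) : |(-9) ^ m * u| = 9 ^ m * |u| := by simp [abs_mul, abs_pow]
  by_cases H : ∃ j : ℕ, 1 / 5 < 9 ^ j * |u| ∧ 9 ^ j * |u| < 19 / 25
  · obtain ⟨j, hj₁, hj₂⟩ := H
    refine ⟨j, fun m hm => ?_⟩
    rw [habs]
    -- One step changes the size by 9, more than the ratio 19/5 of the ends of the support, so every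
    -- other scale misses it.
    rcases lt_or_gt_of_ne hm with h | h
    · obtain ⟨d, rfl⟩ := Nat.exists_eq_add_of_lt h
      have h9 : (9 : ℝ) ≤ 9 ^ (d + 1) := le_self_pow₀ (by norm_num) (by simp)
      rw [add_assoc, pow_add] at hj₂
      have : (0 : ℝ) ≤ 9 ^ m * |u| := by positivity
      left
      nlinarith
    · obtain ⟨d, rfl⟩ := Nat.exists_eq_add_of_lt h
      have h9 : (9 : ℝ) ≤ 9 ^ (d + 1) := le_self_pow₀ (by norm_num) (by simp)
      rw [add_assoc, pow_add]
      right
      nlinarith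
  · push Not at H
    refine ⟨0, fun m _ => ?_⟩
    rw [habs]
    rcases le_or_gt (9 ^ m * |u|) (1 / 5) with h | h
    · exact Or.inl h
    · exact Or.inr (H m h)

/-- The correction of the parabola at one scale, for consecutive critical points `c`, `c'`. -/
noncomputable def bump (c c' u : ℝ) : ℝ :=
  profile (3 - 3 * c) u + profile (4 * c - (1 - c') / 9) (-u)

/-- The derivative of `bump c c'`. -/
noncomputable def bumpDeriv (c c' u : ℝ) : ℝ :=
  profileDeriv (3 - 3 * c) u - profileDeriv (4 * c - (1 - c') / 9) (-u)

lemma hasDerivAt_bump (c c' u : ℝ) : HasDerivAt (bump c c') (bumpDeriv c c' u) u := by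
  refine ((hasDerivAt_profile _ u).add
    ((hasDerivAt_profile (4 * c - (1 - c') / 9) (-u)).comp u (hasDerivAt_neg u))).congr_deriv ?_
  rw [bumpDeriv]
  ring

lemma bump_eq_zero {u : ℝ} (c c' : ℝ) (h : |u| ≤ 1 / 5 ∨ 19 / 25 ≤ |u|) :
    bump c c' u = 0 ∧ bumpDeriv c c' u = 0 := by
  have key (r : ℝ) (v : ℝ) (hv : |v| ≤ 1 / 5 ∨ 19 / 25 ≤ |v|) :
      profile r v = 0 ∧ profileDeriv r v = 0 := by
    rcases le_total v 0 with h₀ | h₀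
    · exact profile_of_le r (by linarith)
    · rw [abs_of_nonneg h₀] at hv
      exact hv.elim (profile_of_le r) (profile_of_ge r)
  have h₁ := key (3 - 3 * c) u h
  have h₂ := key (4 * c - (1 - c') / 9) (-u) (by rwa [abs_neg])
  simp [bump, bumpDeriv, h₁, h₂]

/-- The range allowed for critical points. -/
def critRange : Set ℝ := Icc (11 / 25) (111 / 250)

/-- With x = c + u, the first offset turns the right branch into 3(1 - x), the second turns the left
branch into 3x + c - (1 - c')/9. -/
lemma profile_parameters_mem {c c' : ℝ} (hc : c ∈ critRange) (hc' : c' ∈ critRange) :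
    3 - 3 * c ∈ Icc (83 / 50 : ℝ) (43 / 25) ∧
      4 * c - (1 - c') / 9 ∈ Icc (83 / 50 : ℝ) (43 / 25) := by
  obtain ⟨h₁, h₂⟩ := hc
  obtain ⟨h₃, h₄⟩ := hc'
  refine ⟨⟨?_, ?_⟩, ?_, ?_⟩ <;> linarith

lemma mul_bumpDeriv_lt {c c' u : ℝ} (hc : c ∈ critRange) (hc' : c' ∈ critRange) (hu : u ≠ 0) :
    u * (-(32 / 5) * u + bumpDeriv c c' u) < 0 := by
  obtain ⟨h₁, h₂⟩ := profile_parameters_mem hc hc'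
  rw [bumpDeriv]
  rcases lt_or_gt_of_ne hu with h | h
  · rw [(profile_of_le _ (by linarith)).2]
    have := profileDeriv_lt h₂ (neg_pos.2 h)
    nlinarith
  · rw [(profile_of_le (4 * c - (1 - c') / 9) (z := -u) (by linarith)).2]
    have := profileDeriv_lt h₁ h
    nlinarith

lemma exists_bound_bumpDeriv : ∃ C, 0 ≤ C ∧ ∀ c ∈ critRange, ∀ c' ∈ critRange,
    (∀ u, |bumpDeriv c c' u| ≤ C) ∧
      ∀ u v, |bumpDeriv c c' u - bumpDeriv c c' v| ≤ C * |u - v| := by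
  obtain ⟨C, hC, h⟩ := exists_bound_profileDeriv
  refine ⟨2 * C, by positivity, fun c hc c' hc' => ?_⟩
  obtain ⟨⟨a₁, a₂⟩, b₁, b₂⟩ := profile_parameters_mem hc hc'
  obtain ⟨hb₁, hl₁⟩ := h (3 - 3 * c) ⟨by linarith, by linarith⟩
  obtain ⟨hb₂, hl₂⟩ := h (4 * c - (1 - c') / 9) ⟨by linarith, by linarith⟩
  refine ⟨fun u => ?_, fun u v => ?_⟩
  · refine (abs_sub _ _).trans ?_
    linarith [hb₁ u, hb₂ (-u)]
  · have h₁ := hl₁ u v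
    have h₂ := hl₂ (-u) (-v)
    rw [show -u - -v = -(u - v) by ring, abs_neg] at h₂
    simp only [bumpDeriv]
    rw [abs_le] at h₁ h₂ ⊢
    constructor <;> linarith

/-- The map with critical point `c 0` whose successive renormalizations have critical points
`c 1, c 2, …`. -/
noncomputable def cascade (c : ℕ → ℝ) (x : ℝ) : ℝ :=
  1 - 16 / 5 * (x - c 0) ^ 2 +
    ∑' m : ℕ, (1 / 81) ^ m * bump (c m) (c (m + 1)) ((-9) ^ m * (x - c 0))

/-- The derivative of `cascade c`. -/
noncomputable def cascadeDeriv (c : ℕ → ℝ) (x : ℝ) : ℝ :=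
  -(32 / 5) * (x - c 0) +
    ∑' m : ℕ, (-1 / 9) ^ m * bumpDeriv (c m) (c (m + 1)) ((-9) ^ m * (x - c 0))

/-- The sequence without its first term. -/
def tail (c : ℕ → ℝ) (i : ℕ) : ℝ := c (i + 1)

lemma hasDerivAt_cascade {c : ℕ → ℝ} (hc : ∀ i, c i ∈ critRange) (x : ℝ) :
    HasDerivAt (cascade c) (cascadeDeriv c x) x := by
  obtain ⟨C, hC, h⟩ := exists_bound_bumpDeriv
  have h₁ : HasDerivAt (fun x => 1 - 16 / 5 * (x - c 0) ^ 2) (-(32 / 5) * (x - c 0)) x := by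
    refine ((((hasDerivAt_id x).sub_const (c 0)).pow 2).const_mul (16 / 5)
      |>.const_sub 1).congr_deriv ?_
    simp
    ring
  refine h₁.add ?_
  refine hasDerivAt_tsum (u := fun m => (1 / 9 : ℝ) ^ m * C) (y₀ := c 0)
    ((summable_geometric_of_lt_one (by norm_num) (by norm_num)).mul_right C)
    (g := fun m x => (1 / 81) ^ m * bump (c m) (c (m + 1)) ((-9) ^ m * (x - c 0)))
    (g' := fun m x => (-1 / 9) ^ m * bumpDeriv (c m) (c (m + 1)) ((-9) ^ m * (x - c 0)))
    (fun m y => ?_) (fun m y => ?_) ?_ x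
  · have hy : HasDerivAt (fun x => (-9) ^ m * (x - c 0)) ((-9) ^ m) y := by
      simpa using ((hasDerivAt_id y).sub_const (c 0)).const_mul ((-9 : ℝ) ^ m)
    refine (((hasDerivAt_bump _ _ _).comp y hy).const_mul ((1 / 81 : ℝ) ^ m)).congr_deriv ?_
    -- The amplitude 81^{-m} against the inner factor (-9)^m leaves (-1/9)^m, hence the geometric
    -- majorant.
    rw [show (-1 / 9 : ℝ) = 1 / 81 * -9 by norm_num, mul_pow]
    ring
  · rw [Real.norm_eq_abs, abs_mul, abs_pow, show |(-1 / 9 : ℝ)| = 1 / 9 by norm_num [abs_of_neg]]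
    exact mul_le_mul_of_nonneg_left ((h _ (hc _) _ (hc _)).1 _) (by positivity)
  · have : (fun m : ℕ => (1 / 81) ^ m * bump (c m) (c (m + 1)) ((-9) ^ m * (c 0 - c 0))) = 0 := by
      funext m
      rw [(bump_eq_zero _ _ (Or.inl (by norm_num))).1, mul_zero, Pi.zero_apply]
    rw [this]
    exact summable_zero

/-- At every point only one scale contributes to the derivative. -/
lemma exists_cascadeDeriv_eq (c : ℕ → ℝ) (x : ℝ) : ∃ j : ℕ,
    (∀ m ≠ j, bumpDeriv (c m) (c (m + 1)) ((-9) ^ m * (x - c 0)) = 0) ∧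
    cascadeDeriv c x = -(32 / 5) * (x - c 0) +
      (-1 / 9) ^ j * bumpDeriv (c j) (c (j + 1)) ((-9) ^ j * (x - c 0)) := by
  obtain ⟨j, hj⟩ := exists_scale (x - c 0)
  have h : ∀ m ≠ j, bumpDeriv (c m) (c (m + 1)) ((-9) ^ m * (x - c 0)) = 0 :=
    fun m hm => (bump_eq_zero _ _ (hj m hm)).2
  refine ⟨j, h, ?_⟩
  rw [cascadeDeriv, tsum_eq_single j]
  intro m hm
  rw [h m hm, mul_zero]

/-- Only one scale j is active, and the parabola is self-similar, so a factor 81^{-j} comes out and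
the one-scale estimate `mul_bumpDeriv_lt` applies. -/
lemma mul_cascadeDeriv_neg {c : ℕ → ℝ} (hc : ∀ i, c i ∈ critRange) {x : ℝ} (hx : x ≠ c 0) :
    (x - c 0) * cascadeDeriv c x < 0 := by
  obtain ⟨j, -, hj⟩ := exists_cascadeDeriv_eq c x
  have h9 : (-1 / 9 : ℝ) ^ j * (-9) ^ j = 1 := by
    rw [← mul_pow]
    norm_num
  have hu : (-9 : ℝ) ^ j * (x - c 0) ≠ 0 :=
    mul_ne_zero (pow_ne_zero _ (by norm_num)) (sub_ne_zero.2 hx)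
  have h := mul_bumpDeriv_lt (hc j) (hc (j + 1)) hu
  have hs : 0 < ((-1 / 9 : ℝ) ^ j) ^ 2 :=
    sq_pos_of_ne_zero (pow_ne_zero _ (by norm_num))
  have key : (x - c 0) * cascadeDeriv c x = ((-1 / 9 : ℝ) ^ j) ^ 2 *
      ((-9) ^ j * (x - c 0) * (-(32 / 5) * ((-9) ^ j * (x - c 0)) +
        bumpDeriv (c j) (c (j + 1)) ((-9) ^ j * (x - c 0)))) := by
    rw [hj]
    generalize bumpDeriv (c j) (c (j + 1)) ((-9) ^ j * (x - c 0)) = B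
    linear_combination (-(32 / 5) * (x - c 0) ^ 2 * (-1 - (-1 / 9 : ℝ) ^ j * (-9) ^ j)
      + (x - c 0) * B * (-(-1 / 9 : ℝ) ^ j)) * h9
  rw [key]
  exact mul_neg_of_pos_of_neg hs h

lemma cascadeDeriv_crit {c : ℕ → ℝ} : cascadeDeriv c (c 0) = 0 := by
  obtain ⟨j, -, hj⟩ := exists_cascadeDeriv_eq c (c 0)
  rw [hj, (bump_eq_zero _ _ (Or.inl (by norm_num))).2]
  ring

lemma exists_lipschitzWith_cascadeDeriv {c : ℕ → ℝ} (hc : ∀ i, c i ∈ critRange) :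
    ∃ L, LipschitzWith L (cascadeDeriv c) := by
  obtain ⟨C, hC, h⟩ := exists_bound_bumpDeriv
  refine ⟨Real.toNNReal (32 / 5 + 2 * C), LipschitzWith.of_dist_le_mul fun x y => ?_⟩
  rw [Real.coe_toNNReal _ (by positivity), Real.dist_eq, Real.dist_eq]
  obtain ⟨i, hi, ei⟩ := exists_cascadeDeriv_eq c x
  obtain ⟨j, hj, ej⟩ := exists_cascadeDeriv_eq c y
  set T : ℕ → ℝ → ℝ := fun m z =>
    (-1 / 9) ^ m * bumpDeriv (c m) (c (m + 1)) ((-9) ^ m * (z - c 0)) with hT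
  have hl (m : ℕ) : |T m x - T m y| ≤ C * |x - y| := by
    have := (h _ (hc m) _ (hc (m + 1))).2 ((-9) ^ m * (x - c 0)) ((-9) ^ m * (y - c 0))
    rw [← mul_sub, sub_sub_sub_cancel_right, abs_mul, abs_pow, abs_neg,
      abs_of_pos (show (0 : ℝ) < 9 by norm_num)] at this
    rw [hT]
    simp only
    rw [← mul_sub, abs_mul, abs_pow, show |(-1 / 9 : ℝ)| = 1 / 9 by norm_num [abs_of_neg]]
    calc _ ≤ (1 / 9 : ℝ) ^ m * (C * (9 ^ m * |x - y|)) :=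
          mul_le_mul_of_nonneg_left this (by positivity)
      _ = ((1 / 9 : ℝ) ^ m * 9 ^ m) * (C * |x - y|) := by ring
      _ = C * |x - y| := by rw [← mul_pow]; norm_num
  -- Each T m is Lipschitz with the same constant C. If the active scales differ, T i vanishes at y
  -- and T j at x, so the two increments are estimated separately.
  have key : |T i x - T j y| ≤ 2 * C * |x - y| := by
    by_cases hij : i = j
    · subst hij
      have : 0 ≤ C * |x - y| := by positivity
      linarith [hl i]
    · have h₁ := hl i
      have h₂ := hl j
      have e₁ : T i y = 0 := by simp only [hT]; rw [hj i hij, mul_zero]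
      have e₂ : T j x = 0 := by simp only [hT]; rw [hi j (Ne.symm hij), mul_zero]
      rw [e₁] at h₁
      rw [e₂] at h₂
      rw [abs_le] at h₁ h₂ ⊢
      constructor <;> linarith
  have h0 : |(-(32 / 5) * (x - c 0)) - (-(32 / 5) * (y - c 0))| = 32 / 5 * |x - y| := by
    rw [← mul_sub, sub_sub_sub_cancel_right, abs_mul, abs_neg, abs_of_pos (by norm_num)]
  have := abs_add_le (-(32 / 5) * (x - c 0) - (-(32 / 5) * (y - c 0))) (T i x - T j y)
  rw [ei, ej, show -(32 / 5) * (x - c 0) + T i x - (-(32 / 5) * (y - c 0) + T j y) =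
    -(32 / 5) * (x - c 0) - (-(32 / 5) * (y - c 0)) + (T i x - T j y) by ring]
  linarith

/-! ### Functional equations -/

/-- The chart from `[0,1]` onto the interval of the renormalization. -/
noncomputable def chart₀ (c : ℕ → ℝ) (t : ℝ) : ℝ := c 0 - (t - c 1) / 9

/-- The chart from `[0,1]` onto the first image of the interval of the renormalization. -/
noncomputable def chart₁ (t : ℝ) : ℝ := 1 - (1 - t) / 81

/-- The chart from `[0,1]` onto the second image of the interval of the renormalization. -/
noncomputable def chart₂ (t : ℝ) : ℝ := (1 - t) / 27

lemma cascade_of_far {c : ℕ → ℝ} {x : ℝ} (hx : 19 / 25 ≤ 9 * |x - c 0|) :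
    cascade c x = 1 - 16 / 5 * (x - c 0) ^ 2 + bump (c 0) (c 1) (x - c 0) := by
  rw [cascade, tsum_eq_single 0]
  · simp
  · intro m hm
    obtain ⟨d, rfl⟩ := Nat.exists_eq_add_one_of_ne_zero hm
    rw [(bump_eq_zero _ _ (Or.inr _)).1, mul_zero]
    rw [abs_mul, abs_pow, abs_neg, abs_of_pos (show (0 : ℝ) < 9 by norm_num)]
    have h9 : (9 : ℝ) ≤ 9 ^ (d + 1) := le_self_pow₀ (by norm_num) (by simp)
    nlinarith [abs_nonneg (x - c 0)]

/-- The hypothesis puts the point where the bump m = 0 vanishes; the parabola and the remaining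
terms, reindexed by one, all shrink by 81. -/
lemma cascade_chart₀ {c : ℕ → ℝ} {t : ℝ} (ht : |t - c 1| ≤ 9 / 5) :
    cascade c (chart₀ c t) = chart₁ (cascade (tail c) t) := by
  have hu : chart₀ c t - c 0 = -(t - c 1) / 9 := by rw [chart₀]; ring
  obtain ⟨j, hj⟩ := exists_scale (chart₀ c t - c 0)
  have hsum : Summable fun m : ℕ =>
      (1 / 81) ^ m * bump (c m) (c (m + 1)) ((-9) ^ m * (chart₀ c t - c 0)) := by
    refine summable_of_ne_finset_zero (s := {j}) fun m hm => ?_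
    rw [(bump_eq_zero _ _ (hj m (by simpa using hm))).1, mul_zero]
  rw [cascade, hsum.tsum_eq_zero_add, (bump_eq_zero _ _ (Or.inl _)).1, hu, chart₁, cascade]
  · have (m : ℕ) : (1 / 81 : ℝ) ^ (m + 1) *
        bump (c (m + 1)) (c (m + 1 + 1)) ((-9) ^ (m + 1) * (-(t - c 1) / 9)) =
        1 / 81 * ((1 / 81) ^ m *
          bump (tail c m) (tail c (m + 1)) ((-9) ^ m * (t - tail c 0))) := by
      rw [show (-9 : ℝ) ^ (m + 1) * (-(t - c 1) / 9) = (-9) ^ m * (t - tail c 0) by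
        rw [pow_succ, tail]; ring]
      simp only [tail]
      ring
    simp_rw [this]
    rw [tsum_mul_left]
    simp only [tail, zero_add]
    ring
  · rw [pow_zero, one_mul, hu, abs_div, abs_neg, abs_of_pos (show (0 : ℝ) < 9 by norm_num)]
    linarith

/-- Here x - c_0 lies in [2/5, 14/25], where the cut-off is 1 and the map is 3(1 - x); the end 14/25
is 1 - 11/25. -/
lemma cascade_chart₁ {c : ℕ → ℝ} (hc : c 0 ∈ critRange) {t : ℝ} (ht : t ∈ Icc (0 : ℝ) 1) :
    cascade c (chart₁ t) = chart₂ t := by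
  obtain ⟨h₁, h₂⟩ := hc
  obtain ⟨h₃, h₄⟩ := ht
  have hu : chart₁ t - c 0 = 1 - (1 - t) / 81 - c 0 := by rw [chart₁]
  rw [cascade_of_far, bump, profile_eq, (profile_of_le _ _).1, hu, chart₂]
  · ring
  all_goals rw [hu]
  · linarith
  · linarith
  · linarith
  · rw [abs_of_nonneg] <;> linarith

lemma cascade_chart₂ {c : ℕ → ℝ} (hc : c 0 ∈ critRange) {t : ℝ} (ht : t ∈ Icc (0 : ℝ) 1) :
    cascade c (chart₂ t) = chart₀ c t := by
  obtain ⟨h₁, h₂⟩ := hc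
  obtain ⟨h₃, h₄⟩ := ht
  have hu : chart₂ t - c 0 = (1 - t) / 27 - c 0 := by rw [chart₂]
  rw [cascade_of_far, bump, profile_eq (4 * c 0 - (1 - c 1) / 9), (profile_of_le _ _).1, hu, chart₀]
  · ring
  all_goals rw [hu]
  · linarith
  · linarith
  · linarith
  · rw [abs_of_nonpos] <;> linarith

lemma cascade_crit (c : ℕ → ℝ) : cascade c (c 0) = 1 := by
  have (m : ℕ) : (1 / 81 : ℝ) ^ m * bump (c m) (c (m + 1)) ((-9) ^ m * (c 0 - c 0)) = 0 := by
    rw [(bump_eq_zero _ _ (Or.inl (by norm_num))).1, mul_zero]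
  rw [cascade]
  simp_rw [this]
  simp

lemma cascade_zero {c : ℕ → ℝ} (hc : c 0 ∈ critRange) : cascade c 0 = chart₀ c 1 := by
  have := cascade_chart₂ hc (t := 1) (by simp)
  rwa [chart₂, sub_self, zero_div] at this

lemma cascade_one {c : ℕ → ℝ} (hc : c 0 ∈ critRange) : cascade c 1 = 0 := by
  have := cascade_chart₁ hc (t := 1) (by simp)
  simpa [chart₁, chart₂] using this

/-- After magnification these points sit at 9^{m-j}/10, which is at most 1/10 or at least 9/10, off
the support of every bump. -/
lemma cascade_tip (c : ℕ → ℝ) (j : ℕ) :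
    cascade c (c 0 + (1 / 9) ^ j / 10) = 1 - 16 / 5 * ((1 / 9) ^ j / 10) ^ 2 := by
  have (m : ℕ) : (1 / 81 : ℝ) ^ m *
      bump (c m) (c (m + 1)) ((-9) ^ m * (c 0 + (1 / 9) ^ j / 10 - c 0)) = 0 := by
    rw [(bump_eq_zero _ _ _).1, mul_zero]
    rw [add_sub_cancel_left, abs_mul, abs_pow, abs_neg, abs_of_pos (show (0 : ℝ) < 9 by norm_num),
      abs_of_pos (by positivity)]
    rcases le_or_gt m j with h | h
    · left
      obtain ⟨d, rfl⟩ := Nat.exists_eq_add_of_le h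
      have : (9 : ℝ) ^ m * ((1 / 9) ^ (m + d) / 10) = (9 * (1 / 9)) ^ m * ((1 / 9) ^ d / 10) := by
        rw [pow_add, mul_pow]; ring
      rw [this]
      have : (1 / 9 : ℝ) ^ d ≤ 1 := pow_le_one₀ (by norm_num) (by norm_num)
      norm_num at this ⊢
      linarith
    · right
      obtain ⟨d, rfl⟩ := Nat.exists_eq_add_of_lt h
      have : (9 : ℝ) ^ (j + d + 1) * ((1 / 9) ^ j / 10) = (9 * (1 / 9)) ^ j * (9 ^ (d + 1) / 10) := by
        rw [add_assoc, pow_add, mul_pow]; ring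
      rw [this]
      have : (9 : ℝ) ≤ 9 ^ (d + 1) := le_self_pow₀ (by norm_num) (by simp)
      norm_num
      linarith
  rw [cascade]
  simp_rw [this]
  simp

/-! ### Unimodality -/

lemma cascade_mapsTo {c : ℕ → ℝ} (hc : ∀ i, c i ∈ critRange) :
    MapsTo (cascade c) (Icc 0 1) (Icc 0 1) := by
  have hd (x : ℝ) : deriv (cascade c) x = cascadeDeriv c x := (hasDerivAt_cascade hc x).deriv
  have hdiff : Differentiable ℝ (cascade c) := fun x => (hasDerivAt_cascade hc x).differentiableAt
  have hmono : MonotoneOn (cascade c) (Iic (c 0)) := by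
    refine monotoneOn_of_deriv_nonneg (convex_Iic _) hdiff.continuous.continuousOn
      hdiff.differentiableOn fun x hx => ?_
    rw [interior_Iic, mem_Iio] at hx
    rw [hd]
    nlinarith [mul_cascadeDeriv_neg hc hx.ne]
  have hanti : AntitoneOn (cascade c) (Ici (c 0)) := by
    refine antitoneOn_of_deriv_nonpos (convex_Ici _) hdiff.continuous.continuousOn
      hdiff.differentiableOn fun x hx => ?_
    rw [interior_Ici, mem_Ioi] at hx
    rw [hd]
    nlinarith [mul_cascadeDeriv_neg hc hx.ne']
  obtain ⟨h₁, h₂⟩ := hc 0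
  obtain ⟨h₃, h₄⟩ := hc 1
  intro x hx
  rcases le_total x (c 0) with h | h
  · have l := hmono (show (0 : ℝ) ∈ Iic (c 0) from by rw [mem_Iic]; linarith) h hx.1
    have u := hmono h self_mem_Iic h
    rw [cascade_zero (hc 0), chart₀] at l
    rw [cascade_crit] at u
    exact ⟨by linarith, u⟩
  · have l := hanti h (show (1 : ℝ) ∈ Ici (c 0) from by rw [mem_Ici]; linarith) hx.2
    have u := hanti self_mem_Ici h h
    rw [cascade_one (hc 0)] at l
    rw [cascade_crit] at u
    exact ⟨l, u⟩

lemma derivWithin_eq_cascadeDeriv {f : ℝ → ℝ} {c : ℕ → ℝ} (hc : ∀ i, c i ∈ critRange)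
    (hf : EqOn f (cascade c) (Icc 0 1)) :
    EqOn (derivWithin f (Icc 0 1)) (cascadeDeriv c) (Icc 0 1) := by
  intro x hx
  rw [derivWithin_congr hf (hf hx)]
  exact (hasDerivAt_cascade hc x).hasDerivWithinAt.derivWithin
    (uniqueDiffOn_Icc zero_lt_one x hx)

lemma contDiffOn_of_eqOn_cascade {f : ℝ → ℝ} {c : ℕ → ℝ} (hc : ∀ i, c i ∈ critRange)
    (hf : EqOn f (cascade c) (Icc 0 1)) : ContDiffOn ℝ 1 f (Icc 0 1) := by
  refine ContDiffOn.congr (ContDiff.contDiffOn ?_) hf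
  obtain ⟨L, hL⟩ := exists_lipschitzWith_cascadeDeriv hc
  refine contDiff_one_iff_deriv.2
    ⟨fun x => (hasDerivAt_cascade hc x).differentiableAt, ?_⟩
  rw [show deriv (cascade c) = cascadeDeriv c from
    funext fun x => (hasDerivAt_cascade hc x).deriv]
  exact hL.continuous

lemma isC1Lip_of_eqOn_cascade {f : ℝ → ℝ} {c : ℕ → ℝ} (hc : ∀ i, c i ∈ critRange)
    (hf : EqOn f (cascade c) (Icc 0 1)) : IsC1Lip f := by
  obtain ⟨L, hL⟩ := exists_lipschitzWith_cascadeDeriv hc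
  refine ⟨contDiffOn_of_eqOn_cascade hc hf, L, fun x hx y hy => ?_⟩
  rw [derivWithin_eq_cascadeDeriv hc hf hx, derivWithin_eq_cascadeDeriv hc hf hy]
  exact hL x y

lemma critRange_subset_Ioo : critRange ⊆ Ioo 0 1 := by
  rintro x ⟨h₁, h₂⟩
  constructor <;> linarith

lemma isUnimodal_of_eqOn_cascade {f : ℝ → ℝ} {c : ℕ → ℝ} (hc : ∀ i, c i ∈ critRange)
    (hf : EqOn f (cascade c) (Icc 0 1)) : IsUnimodal f (c 0) where
  mapsTo x hx := by
    rw [hf hx]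
    exact cascade_mapsTo hc hx
  contDiffOn := contDiffOn_of_eqOn_cascade hc hf
  crit_mem := critRange_subset_Ioo (hc 0)
  crit_iff x hx := by
    rw [derivWithin_eq_cascadeDeriv hc hf hx]
    refine ⟨fun h => ?_, fun h => h ▸ cascadeDeriv_crit⟩
    by_contra hne
    have := mul_cascadeDeriv_neg hc hne
    rw [h, mul_zero] at this
    exact lt_irrefl _ this
  map_crit := by
    rw [hf (Ioo_subset_Icc_self (critRange_subset_Ioo (hc 0))), cascade_crit]
  map_one := by rw [hf (right_mem_Icc.2 zero_le_one), cascade_one (hc 0)]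

lemma hasQuadraticTip_cascade {c : ℕ → ℝ} (hc : c 0 ∈ critRange) :
    HasQuadraticTip (cascade c) (c 0) := by
  refine ⟨fun j => c 0 + (1 / 9) ^ j / 10, 16 / 5, by norm_num, fun j => ?_, ?_, ?_⟩
  · have h₁ : (0 : ℝ) < (1 / 9) ^ j / 10 := by positivity
    have h₂ : (1 / 9 : ℝ) ^ j ≤ 1 := pow_le_one₀ (by norm_num) (by norm_num)
    obtain ⟨h₃, h₄⟩ := hc
    exact ⟨⟨by linarith, by linarith⟩, by linarith⟩
  · have := ((tendsto_pow_atTop_nhds_zero_of_lt_one (r := (1 / 9 : ℝ)) (by norm_num)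
      (by norm_num)).div_const 10).const_add (c 0)
    simpa using this
  · refine tendsto_const_nhds.congr fun j => ?_
    have h₁ : (1 / 9 : ℝ) ^ j / 10 ≠ 0 := by positivity
    rw [cascade_tip, cascade_crit, add_sub_cancel_left]
    field_simp
    ring

/-! ### Cycles of intervals -/

/-- `f^[N]` maps `S` to itself, and `S, f '' S, …, f^[N - 1] '' S` are pairwise disjoint. -/
structure IsCycleOfSets (f : ℝ → ℝ) (S : Set ℝ) (N : ℕ) : Prop where
  mapsTo : MapsTo f^[N] S S
  ne : ∀ i < N, ∀ j < N, i ≠ j → ∀ x ∈ S, ∀ y ∈ S, f^[i] x ≠ f^[j] y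

/-- Points in the second and third intervals are one iterate of g ahead. When an index reaches N it
wraps around to 0 by invariance of S; distinct indices cannot both wrap. -/
lemma IsCycleOfSets.succ_ne {g : ℝ → ℝ} {S : Set ℝ} {N : ℕ} (H : IsCycleOfSets g S N) {i j : ℕ}
    (hi : i < N) (hj : j < N) (hij : i ≠ j) {x y : ℝ} (hx : x ∈ S) (hy : y ∈ S) :
    g^[i + 1] x ≠ g^[j + 1] y := by
  rcases Nat.lt_or_ge (i + 1) N with h₁ | h₁ <;> rcases Nat.lt_or_ge (j + 1) N with h₂ | h₂
  · exact H.ne _ h₁ _ h₂ (by omega) x hx y hy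
  · obtain rfl : N = j + 1 := by omega
    exact H.ne _ h₁ 0 (by omega) (by omega) x hx _ (H.mapsTo hy)
  · obtain rfl : N = i + 1 := by omega
    exact H.ne 0 (by omega) _ h₂ (by omega) _ (H.mapsTo hx) y hy
  · omega

lemma iterate_three_mul {f g h₀ h₁ h₂ : ℝ → ℝ} {I : Set ℝ} (hg : MapsTo g I I)
    (e₀ : ∀ t ∈ I, f (h₀ t) = h₁ (g t)) (e₁ : ∀ t ∈ I, f (h₁ t) = h₂ t)
    (e₂ : ∀ t ∈ I, f (h₂ t) = h₀ t) (q : ℕ) {t : ℝ} (ht : t ∈ I) :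
    f^[3 * q] (h₀ t) = h₀ (g^[q] t) := by
  induction q with
  | zero => rfl
  | succ q ih =>
    have hq : g^[q] t ∈ I := hg.iterate q ht
    rw [show 3 * (q + 1) = 3 + 3 * q by ring, Function.iterate_add_apply, ih,
      Function.iterate_succ_apply' g]
    simp only [Function.iterate_succ_apply, Function.iterate_zero, id_eq]
    rw [e₀ _ hq, e₁ _ (hg hq), e₂ _ (hg hq)]

lemma IsCycleOfSets.three_mul {f g h₀ h₁ h₂ : ℝ → ℝ} {I S : Set ℝ} {N : ℕ}
    (H : IsCycleOfSets g S N) (hS : S ⊆ I) (hg : MapsTo g I I)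
    (e₀ : ∀ t ∈ I, f (h₀ t) = h₁ (g t)) (e₁ : ∀ t ∈ I, f (h₁ t) = h₂ t)
    (e₂ : ∀ t ∈ I, f (h₂ t) = h₀ t)
    (i₀ : Function.Injective h₀) (i₁ : Function.Injective h₁) (i₂ : Function.Injective h₂)
    (d₀₁ : ∀ s ∈ I, ∀ t ∈ I, h₀ s ≠ h₁ t) (d₀₂ : ∀ s ∈ I, ∀ t ∈ I, h₀ s ≠ h₂ t)
    (d₁₂ : ∀ s ∈ I, ∀ t ∈ I, h₁ s ≠ h₂ t) : IsCycleOfSets f (h₀ '' S) (3 * N) := by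
  have iter₀ (q : ℕ) {t : ℝ} (ht : t ∈ I) : f^[3 * q] (h₀ t) = h₀ (g^[q] t) :=
    iterate_three_mul hg e₀ e₁ e₂ q ht
  have iter₁ (q : ℕ) {t : ℝ} (ht : t ∈ I) : f^[3 * q + 1] (h₀ t) = h₁ (g^[q + 1] t) := by
    rw [Function.iterate_succ_apply', iter₀ q ht, e₀ _ (hg.iterate q ht),
      Function.iterate_succ_apply' g]
  have iter₂ (q : ℕ) {t : ℝ} (ht : t ∈ I) : f^[3 * q + 2] (h₀ t) = h₂ (g^[q + 1] t) := by
    rw [Function.iterate_succ_apply', iter₁ q ht, e₁ _ (hg.iterate (q + 1) ht)]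
  refine ⟨?_, ?_⟩
  · rintro _ ⟨t, ht, rfl⟩
    rw [iter₀ N (hS ht)]
    exact mem_image_of_mem _ (H.mapsTo ht)
  · rintro i hi j hj hij _ ⟨x, hx, rfl⟩ _ ⟨y, hy, rfl⟩
    -- The residue mod 3 says which of the three intervals is visited; equal residues reduce to the
    -- cycle of g.
    obtain ⟨p, r, hr, rfl⟩ : ∃ p r, r < 3 ∧ i = 3 * p + r :=
      ⟨i / 3, i % 3, Nat.mod_lt _ (by norm_num), (Nat.div_add_mod i 3).symm⟩
    obtain ⟨q, s, hs, rfl⟩ : ∃ q s, s < 3 ∧ j = 3 * q + s :=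
      ⟨j / 3, j % 3, Nat.mod_lt _ (by norm_num), (Nat.div_add_mod j 3).symm⟩
    have hx' := hS hx
    have hy' := hS hy
    have mx (n : ℕ) : g^[n] x ∈ I := hg.iterate n hx'
    have my (n : ℕ) : g^[n] y ∈ I := hg.iterate n hy'
    have hp : p < N := by omega
    have hq : q < N := by omega
    interval_cases r <;> interval_cases s <;>
      simp only [add_zero, iter₀ _ hx', iter₀ _ hy', iter₁ _ hx', iter₁ _ hy', iter₂ _ hx',
        iter₂ _ hy']
    · exact i₀.ne (H.ne p hp q hq (by omega) x hx y hy)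
    · exact d₀₁ _ (mx _) _ (my _)
    · exact d₀₂ _ (mx _) _ (my _)
    · exact (d₀₁ _ (my _) _ (mx _)).symm
    · exact i₁.ne (H.succ_ne hp hq (by omega) hx hy)
    · exact d₁₂ _ (mx _) _ (my _)
    · exact (d₀₂ _ (my _) _ (mx _)).symm
    · exact (d₁₂ _ (my _) _ (mx _)).symm
    · exact i₂.ne (H.succ_ne hp hq (by omega) hx hy)

lemma IsCycleOfSets.isRenormalization {f : ℝ → ℝ} {a b : ℝ} {N : ℕ}
    (H : IsCycleOfSets f (Icc a b) N) (hN : 0 < N) (hab : a < b) (hsub : Icc a b ⊆ Icc 0 1)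
    (h0 : a ≠ 0) : IsRenormalization f a b N where
  pos := hN
  lt := hab
  proper := by
    refine ⟨hsub, fun h => h0 (le_antisymm ?_ ?_)⟩
    · exact (h (left_mem_Icc.2 zero_le_one)).1
    · exact (hsub (left_mem_Icc.2 hab.le)).1
  disjoint i hi j hj hij := by
    refine Disjoint.mono interior_subset interior_subset (Set.disjoint_left.2 ?_)
    rintro _ ⟨x, hx, rfl⟩ ⟨y, hy, hxy⟩
    exact H.ne i hi j hj hij x hx y hy hxy.symm
  mapsTo := H.mapsTo

/-! ### The nested intervals of the cascade -/

/-- The composition of the first `m` renormalization charts. -/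
noncomputable def towerChart (m : ℕ) (c : ℕ → ℝ) (t : ℝ) : ℝ := c 0 + (-1 / 9) ^ m * (t - c m)

lemma towerChart_succ (m : ℕ) (c : ℕ → ℝ) (t : ℝ) :
    towerChart (m + 1) c t = chart₀ c (towerChart m (tail c) t) := by
  simp only [towerChart, chart₀, tail, zero_add]
  ring

/-- Splitting off the innermost chart gives nesting, whereas splitting off the outermost one drives
the inductions. -/
lemma towerChart_succ' (m : ℕ) (c : ℕ → ℝ) (t : ℝ) :
    towerChart (m + 1) c t = towerChart m c (c m - (t - c (m + 1)) / 9) := by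
  simp only [towerChart]
  ring

lemma tail_mem {c : ℕ → ℝ} (hc : ∀ i, c i ∈ critRange) (i : ℕ) : tail c i ∈ critRange := hc (i + 1)

lemma chart₀_bounds {c : ℕ → ℝ} (hc : ∀ i, c i ∈ critRange) {t : ℝ} (ht : t ∈ Icc (0 : ℝ) 1) :
    1 / 3 < chart₀ c t ∧ chart₀ c t < 1 / 2 := by
  obtain ⟨h₁, h₂⟩ := hc 0
  obtain ⟨h₃, h₄⟩ := hc 1
  obtain ⟨h₅, h₆⟩ := ht
  rw [chart₀]
  constructor <;> linarith

lemma chart₀_mem {c : ℕ → ℝ} (hc : ∀ i, c i ∈ critRange) {t : ℝ} (ht : t ∈ Icc (0 : ℝ) 1) :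
    chart₀ c t ∈ Icc (0 : ℝ) 1 := by
  have := chart₀_bounds hc ht
  exact ⟨by linarith, by linarith⟩

lemma chart₁_mem {t : ℝ} (ht : t ∈ Icc (0 : ℝ) 1) : chart₁ t ∈ Icc (0 : ℝ) 1 := by
  rw [chart₁]
  exact ⟨by linarith [ht.1], by linarith [ht.2]⟩

lemma chart₂_mem {t : ℝ} (ht : t ∈ Icc (0 : ℝ) 1) : chart₂ t ∈ Icc (0 : ℝ) 1 := by
  rw [chart₂]
  exact ⟨by linarith [ht.2], by linarith [ht.1]⟩

lemma towerChart_mem (m : ℕ) {c : ℕ → ℝ} (hc : ∀ i, c i ∈ critRange) {t : ℝ}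
    (ht : t ∈ Icc (0 : ℝ) 1) : towerChart m c t ∈ Icc (0 : ℝ) 1 := by
  induction m generalizing c with
  | zero => simpa [towerChart] using ht
  | succ m ih =>
    rw [towerChart_succ]
    exact chart₀_mem hc (ih (tail_mem hc))

/-! ### Renormalization of maps that agree with a cascade on the unit interval -/

section EqOnCascade

variable {f : ℝ → ℝ} {c : ℕ → ℝ} {t : ℝ}

lemma apply_chart₀ (hc : ∀ i, c i ∈ critRange) (hf : EqOn f (cascade c) (Icc 0 1))
    (ht : t ∈ Icc (0 : ℝ) 1) : f (chart₀ c t) = chart₁ (cascade (tail c) t) := by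
  obtain ⟨h₁, h₂⟩ := hc 1
  rw [hf (chart₀_mem hc ht), cascade_chart₀]
  rw [abs_le]
  exact ⟨by linarith [ht.1], by linarith [ht.2]⟩

lemma apply_chart₁ (hc : ∀ i, c i ∈ critRange) (hf : EqOn f (cascade c) (Icc 0 1))
    (ht : t ∈ Icc (0 : ℝ) 1) : f (chart₁ t) = chart₂ t := by
  rw [hf (chart₁_mem ht), cascade_chart₁ (hc 0) ht]

lemma apply_chart₂ (hc : ∀ i, c i ∈ critRange) (hf : EqOn f (cascade c) (Icc 0 1))
    (ht : t ∈ Icc (0 : ℝ) 1) : f (chart₂ t) = chart₀ c t := by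
  rw [hf (chart₂_mem ht), cascade_chart₂ (hc 0) ht]

lemma iterate_three_chart₀ (hc : ∀ i, c i ∈ critRange) (hf : EqOn f (cascade c) (Icc 0 1))
    (ht : t ∈ Icc (0 : ℝ) 1) : f^[3] (chart₀ c t) = chart₀ c (cascade (tail c) t) := by
  simpa using iterate_three_mul (cascade_mapsTo (tail_mem hc)) (fun _ => apply_chart₀ hc hf)
    (fun _ => apply_chart₁ hc hf) (fun _ => apply_chart₂ hc hf) 1 ht

lemma apply_zero (hc : ∀ i, c i ∈ critRange) (hf : EqOn f (cascade c) (Icc 0 1)) :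
    f 0 = chart₀ c 1 := by
  rw [hf (left_mem_Icc.2 zero_le_one), cascade_zero (hc 0)]

lemma iterate_four_zero (hc : ∀ i, c i ∈ critRange) (hf : EqOn f (cascade c) (Icc 0 1)) :
    f^[4] 0 = chart₀ c 0 := by
  rw [Function.iterate_succ_apply, apply_zero hc hf,
    iterate_three_chart₀ hc hf (right_mem_Icc.2 zero_le_one), cascade_one (tail_mem hc 0)]

/-- The renormalization of a cascade is the cascade of the shifted sequence. -/
lemma eqOn_triplingRenorm (hc : ∀ i, c i ∈ critRange) (hf : EqOn f (cascade c) (Icc 0 1)) :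
    EqOn (triplingRenorm f) (cascade (tail c)) (Icc 0 1) := by
  intro t ht
  have hh : triplingChart f t = chart₀ c t := by
    rw [triplingChart, apply_zero hc hf, iterate_four_zero hc hf]
    simp only [chart₀]
    ring
  rw [triplingRenorm, Function.comp_apply, Function.comp_apply, hh, iterate_three_chart₀ hc hf ht,
    triplingChartInv, apply_zero hc hf, iterate_four_zero hc hf]
  simp only [chart₀]
  field

/-- The induction lets f and `c` vary: a cycle of length 3^m for the tail is lifted through `chart₀`
to one of length 3^(m+1). -/
lemma isCycleOfSets_tower (m : ℕ) (hc : ∀ i, c i ∈ critRange)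
    (hf : EqOn f (cascade c) (Icc 0 1)) :
    IsCycleOfSets f (towerChart m c '' Icc 0 1) (3 ^ m) := by
  induction m generalizing f c with
  | zero =>
    have : towerChart 0 c = id := by
      funext t
      simp [towerChart]
    rw [this, image_id, pow_zero]
    refine ⟨(isUnimodal_of_eqOn_cascade hc hf).mapsTo, fun i hi j hj hij => ?_⟩
    omega
  | succ m ih =>
    have : towerChart (m + 1) c '' Icc 0 1 =
        chart₀ c '' (towerChart m (tail c) '' Icc 0 1) := by
      rw [image_image]
      exact image_congr fun t _ => towerChart_succ m c t
    rw [this, pow_succ']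
    refine (ih (tail_mem hc) (eqOn_refl _ _)).three_mul (I := Icc 0 1) (h₁ := chart₁) (h₂ := chart₂)
      (image_subset_iff.2 fun t ht => towerChart_mem m (tail_mem hc) ht)
      (cascade_mapsTo (tail_mem hc)) (fun _ => apply_chart₀ hc hf)
      (fun _ => apply_chart₁ hc hf) (fun _ => apply_chart₂ hc hf) ?_ ?_ ?_ ?_ ?_ ?_
    · intro x y h
      simp only [chart₀] at h
      linarith
    · intro x y h
      simp only [chart₁] at h
      linarith
    · intro x y h
      simp only [chart₂] at h
      linarith
    · intro s hs t ht h
      have := chart₀_bounds hc hs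
      simp only [chart₁] at h
      linarith [ht.1]
    · intro s hs t ht h
      have := chart₀_bounds hc hs
      simp only [chart₂] at h
      linarith [ht.1]
    · intro s hs t ht h
      simp only [chart₁, chart₂] at h
      linarith [hs.1, ht.1]

/-- The min and max are needed because the orientation of the chart alternates with m. -/
lemma towerChart_image (m : ℕ) (c : ℕ → ℝ) : towerChart m c '' Icc 0 1 =
    Icc (min (towerChart m c 0) (towerChart m c 1)) (max (towerChart m c 0) (towerChart m c 1)) := by
  have : towerChart m c = (fun x => x + (c 0 - (-1 / 9) ^ m * c m)) ∘ ((-1 / 9) ^ m * ·) := by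
    funext t
    simp only [towerChart, Function.comp_apply]
    ring
  rw [Icc_min_max, ← uIcc_of_le zero_le_one, this, image_comp, image_const_mul_uIcc,
    image_add_const_uIcc]
  rfl

lemma isRenormalization_tower (n : ℕ) (hc : ∀ i, c i ∈ critRange)
    (hf : EqOn f (cascade c) (Icc 0 1)) :
    IsRenormalization f (min (towerChart (n + 1) c 0) (towerChart (n + 1) c 1))
      (max (towerChart (n + 1) c 0) (towerChart (n + 1) c 1)) (3 ^ (n + 1)) := by
  have hpos {t : ℝ} (ht : t ∈ Icc (0 : ℝ) 1) : 0 < towerChart (n + 1) c t := by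
    rw [towerChart_succ]
    linarith [(chart₀_bounds hc (towerChart_mem n (tail_mem hc) ht)).1]
  have H := isCycleOfSets_tower (n + 1) hc hf
  have hsub : towerChart (n + 1) c '' Icc 0 1 ⊆ Icc 0 1 :=
    image_subset_iff.2 fun t ht => towerChart_mem (n + 1) hc ht
  rw [towerChart_image] at H hsub
  refine H.isRenormalization (by positivity) (min_lt_max.2 fun h => ?_) hsub
    (lt_min (hpos (by simp)) (hpos (by simp))).ne'
  simp only [towerChart] at h
  have h9 : (-1 / 9 : ℝ) ^ (n + 1) ≠ 0 := pow_ne_zero _ (by norm_num)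
  exact h9 (by linarith)

lemma isInfinitelyRenormalizable_of_eqOn_cascade (hc : ∀ i, c i ∈ critRange)
    (hf : EqOn f (cascade c) (Icc 0 1)) :
    IsInfinitelyRenormalizable f (fun n => 3 ^ (n + 1)) := by
  refine ⟨_, _, fun n => isRenormalization_tower n hc hf, fun n => ?_, ?_⟩
  · rw [← towerChart_image, ← towerChart_image]
    rintro _ ⟨t, ht, rfl⟩
    rw [towerChart_succ']
    exact mem_image_of_mem _ (chart₀_mem (c := fun i => c (n + 1 + i)) (fun i => hc _) ht)
  · have h := (tendsto_pow_atTop_nhds_zero_of_lt_one (r := (1 / 9 : ℝ)) (by norm_num)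
      (by norm_num)).comp (tendsto_add_atTop_nat 1)
    refine h.congr fun n => ?_
    rw [max_sub_min_eq_abs, Function.comp_apply]
    simp only [towerChart]
    rw [show c 0 + (-1 / 9) ^ (n + 1) * (1 - c (n + 1)) - (c 0 + (-1 / 9) ^ (n + 1) *
      (0 - c (n + 1))) = (-1 / 9) ^ (n + 1) by ring, abs_pow]
    norm_num [abs_of_neg]

lemma isTriplingRenormalizable_of_eqOn_cascade (hc : ∀ i, c i ∈ critRange)
    (hf : EqOn f (cascade c) (Icc 0 1)) : IsTriplingRenormalizable f (c 0) := by
  have h₀ : towerChart 1 c 0 = chart₀ c 0 := by simp only [towerChart, chart₀]; ring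
  have h₁ : towerChart 1 c 1 = chart₀ c 1 := by simp only [towerChart, chart₀]; ring
  have hlt : chart₀ c 1 < chart₀ c 0 := by simp only [chart₀]; linarith
  have h := isRenormalization_tower 0 hc hf
  rw [zero_add, h₀, h₁, min_eq_right hlt.le, max_eq_left hlt.le] at h
  obtain ⟨h₂, h₃⟩ := critRange_subset_Ioo (hc 1)
  rw [IsTriplingRenormalizable, apply_zero hc hf, iterate_four_zero hc hf]
  refine ⟨h, ?_, ?_⟩ <;> simp only [chart₀] <;> linarith

end EqOnCascade

lemma eqOn_iterate_triplingRenorm {c : ℕ → ℝ} (hc : ∀ i, c i ∈ critRange) (n : ℕ) :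
    EqOn (triplingRenorm^[n] (cascade c)) (cascade fun i => c (i + n)) (Icc 0 1) := by
  induction n with
  | zero => exact eqOn_refl _ _
  | succ n ih =>
    rw [Function.iterate_succ_apply']
    have := eqOn_triplingRenorm (fun i => hc (i + n)) ih
    convert this using 2
    funext i
    simp only [tail]
    congr 1
    ring

/-! ### A Cantor set of critical points -/

lemma perfect_range_of_isEmbedding {φ : (ℕ → Bool) → ℝ} (hφ : IsEmbedding φ) :
    Perfect (range φ) := by
  refine ⟨(isCompact_range hφ.continuous).isClosed, preperfect_iff_nhds.2 ?_⟩
  rintro _ ⟨y, rfl⟩ U hU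
  -- Flipping the n-th bit of y gives points different from y that converge to it.
  have hlim : Tendsto (fun n => Function.update y n (!y n)) atTop (𝓝 y) := by
    refine tendsto_pi_nhds.2 fun i => tendsto_const_nhds.congr' ?_
    filter_upwards [eventually_gt_atTop i] with n hn
    rw [Function.update_of_ne hn.ne]
  obtain ⟨n, hn⟩ := ((hφ.continuous.tendsto y).comp hlim |>.eventually hU).exists
  refine ⟨_, ⟨hn, mem_range_self _⟩, fun h => ?_⟩
  have := congrFun (hφ.injective h) n
  simp at this

lemma exists_isCantorSet_subset_critRange : ∃ C ⊆ critRange, IsCantorSet C := by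
  -- The ternary Cantor set is rescaled to `critRange`, whose length is 1/250.
  set φ : (ℕ → Bool) → ℝ := fun y =>
    11 / 25 + 1 / 250 * (cantorSetHomeomorphNatToBool.symm y : ℝ) with hφ
  have hemb : IsEmbedding φ := by
    have hcont : Continuous φ := by fun_prop
    refine (hcont.isClosedEmbedding fun x y h => ?_).isEmbedding
    exact cantorSetHomeomorphNatToBool.symm.injective
      (Subtype.ext (by simp only [hφ] at h; linarith))
  refine ⟨range φ, ?_, range_nonempty _, isCompact_range hemb.continuous,
    perfect_range_of_isEmbedding hemb,
    hemb.isTotallyDisconnected_range.2 inferInstance⟩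
  rintro _ ⟨y, rfl⟩
  obtain ⟨h₁, h₂⟩ := cantorSet_subset_unitInterval (cantorSetHomeomorphNatToBool.symm y).2
  refine ⟨?_, ?_⟩ <;> simp only [hφ] <;> linarith

lemma exists_seq_dense_in {C : Set ℝ} (hC : C.Nonempty) :
    ∃ c : ℕ → ℝ, range c ⊆ C ∧ C ⊆ closure (range c) := by
  have : Nonempty C := hC.to_subtype
  refine ⟨fun n => (TopologicalSpace.denseSeq C n : ℝ), ?_, fun x hx => ?_⟩
  · rintro _ ⟨n, rfl⟩
    exact Subtype.coe_prop _
  · have h := image_closure_subset_closure_image continuous_subtype_val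
      (mem_image_of_mem _ (TopologicalSpace.denseRange_denseSeq C ⟨x, hx⟩))
    rwa [← range_comp] at h

theorem mainTheorem5 :
    ∃ (k : ℝ → ℝ) (c : ℕ → ℝ),
      IsUnimodal k (c 0) ∧ IsC1Lip k ∧ HasQuadraticTip k (c 0) ∧
      IsInfinitelyRenormalizable k (fun n => 3 ^ (n + 1)) ∧
      (∀ n, IsUnimodal (triplingRenorm^[n] k) (c n) ∧ IsC1Lip (triplingRenorm^[n] k) ∧
        IsTriplingRenormalizable (triplingRenorm^[n] k) (c n)) ∧
      ∃ C : Set ℝ, IsCantorSet C ∧ range c ⊆ C ∧ C ⊆ closure (range c) := by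
  obtain ⟨C, hCsub, hC⟩ := exists_isCantorSet_subset_critRange
  obtain ⟨c, hcC, hdense⟩ := exists_seq_dense_in hC.1
  have hc (i : ℕ) : c i ∈ critRange := hCsub (hcC (mem_range_self i))
  refine ⟨cascade c, c, isUnimodal_of_eqOn_cascade hc (eqOn_refl _ _),
    isC1Lip_of_eqOn_cascade hc (eqOn_refl _ _), hasQuadraticTip_cascade (hc 0),
    isInfinitelyRenormalizable_of_eqOn_cascade hc (eqOn_refl _ _), fun n => ?_,
    C, hC, hcC, hdense⟩
  have hn := eqOn_iterate_triplingRenorm hc n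
  have hc' (i : ℕ) : c (i + n) ∈ critRange := hc _
  have hu := isUnimodal_of_eqOn_cascade hc' hn
  have ht := isTriplingRenormalizable_of_eqOn_cascade hc' hn
  rw [zero_add] at hu ht
  exact ⟨hu, isC1Lip_of_eqOn_cascade hc' hn, ht⟩
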